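/- Let $T\ge 0$, let $\mathbb R^n$ carry any norm $\|\cdot\|$, and write $\|u\|_\infty=\sup_{t\in[0,T]}\|u(t)\|$. Let $x^*:[0,T]\to\mathbb R^n$ solve $\dot x^*(t)=f(x^*(t),t)$ on $[0,T]$ with $x^*(0)=x_0$, where $f$ is continuously differentiable on a relatively open subset of $\mathbb R^n\times[0,T]$ that contains the graph of $x^*$. For boundary data consisting of a $C^1$ function $y_0:[0,T]\to\mathbb R^n$ and a sequence $\xi=(\xi_{k+1})_{k\ge0}$ in $\mathbb R^n$, consider the Picard iterates with varying initial states, i.e. the differential repetitive process $$\dot x_{k+1}(t)=f(y_k(t),t),\qquad x_{k+1}(0)=\xi_{k+1},\qquad y_{k+1}(t)=x_{k+1}(t),\qquad t\in[0,T],\ k\in\mathbb N .$$ For $\lambda\in(0,1]$ put $\|b\|_{e_\lambda}=\sup_{k\ge0}\lambda^{-k}\|b_{k+1}\|\in[0,\infty]$, and put $N_\lambda(y_0,\xi)=\|y_0-x^*\|_\infty+\|(\xi_{k+1}-x_0)_{k\ge0}\|_{e_\lambda}$. Then the process is locally exponentially stable around $x^*$, that is, the origin is exponentially stable for the process in the coordinates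 $(x_k-x^*,\,y_k-x^*)$: 1. (Lyapunov stability) for every $\epsilon>0$ there is $\delta_1\in(0,\epsilon)$ such that, if $N_1(y_0,\xi)<\delta_1$, then the process has exactly one solution and $\|y_k-x^*\|_\infty<\epsilon$ for all $k\in\mathbb N$; 2. (asymptotic stability) there is $\delta_2>0$ such that, if $N_1(y_0,\xi)<\delta_2$ and $\xi_k\to x_0$, then the process has exactly one solution and $\|y_k-x^*\|_\infty\to0$; 3. (exponential stability) there are $\delta_3>0$ and continuous, strictly increasing functions $K:(0,1)\to[1,\infty)$ and $\gamma:(0,1)\to(0,1)$ such that, for all $\lambda\in(0,1)$, if $N_\lambda(y_0,\xi)<\delta_3$, then the process has exactly one solution and $$\|y_k-x^*\|_\infty\le K(\lambda)\,\gamma(\lambda)^k\,N_\lambda(y_0,\xi)\qquad\text{for all }k\in\mathbb N .$$ In particular, the Picard iterates $y_k$ converge uniformly on $[0,T]$ to $x^*$ for every initial state sequence with $\xi_k\to x_0$ (that is, $(\xi_{k+1}-x_0)_{k\ge0}\in c_0$), provided that the boundary data are close enough to $(x^*,x_0)$, in the sense that $N_1(y_0,\xi)<\delta$ for some $\delta>0$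 that does not depend on $y_0$ and $\xi$. -/

import Mathlib

open Set Filter Topology
open scoped ENNReal

/-- The data of a differential repetitive process (DRP) on the time interval `[0, T]`:
`x_{k+1}' (t) = f (x_{k+1} t) (y_k t) t` and `y_{k+1} t = g (x_{k+1} t) (y_k t) t`. The states live in
`E` and the outputs in `F`; a finite-dimensional real normed space is `ℝ^p` with an arbitrary norm. -/
structure DRP (E F : Type*) where
  T : ℝ
  f : E → F → ℝ → E
  g : E → F → ℝ → F

/-- The uniform norm on `[0, T]`, with values in `[0, ∞]`; it is the `L_∞` norm of a function that is
continuous on `[0, T]`, `T > 0`. -/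
noncomputable def supNorm {E : Type*} [NormedAddCommGroup E] (T : ℝ) (u : ℝ → E) : ℝ≥0∞ :=
  ⨆ t ∈ Icc (0 : ℝ) T, ‖u t‖ₑ

/-- The exponential norm `sup_k l^{-k} ‖b_{k+1}‖`, with values in `[0, ∞]`. The entry `b_{k+1}` of the
sequence is written `b k`, so that sequences are indexed from `0`. -/
noncomputable def expNorm {E : Type*} [NormedAddCommGroup E] (l : ℝ) (b : ℕ → E) : ℝ≥0∞ :=
  ⨆ k : ℕ, ENNReal.ofReal ((l ^ k)⁻¹) * ‖b k‖ₑ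

namespace DRP

variable {E F : Type*} [NormedAddCommGroup E] [NormedSpace ℝ E]
  [NormedAddCommGroup F] [NormedSpace ℝ F]

/-- `(x, y)` solves the DRP with boundary data `y_0 = y0` and `x_{k+1}(0) = ξ k`, all outputs being
continuously differentiable on `[0, T]`. Only the restrictions to `[0, T]` of `y k` and `x (k + 1)`,
`k = 0, 1, …`, are part of the solution; `x 0` plays no role. -/
structure IsSolution (S : DRP E F) (y0 : ℝ → F) (ξ : ℕ → E) (x : ℕ → ℝ → E) (y : ℕ → ℝ → F) :
    Prop where
  output_zero : EqOn (y 0) y0 (Icc 0 S.T)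
  output_contDiff : ∀ k, ContDiffOn ℝ 1 (y k) (Icc 0 S.T)
  state_zero : ∀ k, x (k + 1) 0 = ξ k
  state_deriv : ∀ k, ∀ t ∈ Icc 0 S.T,
    HasDerivWithinAt (x (k + 1)) (S.f (x (k + 1) t) (y k t) t) (Icc 0 S.T) t
  output_succ : ∀ k, ∀ t ∈ Icc 0 S.T, y (k + 1) t = S.g (x (k + 1) t) (y k t) t

/-- The DRP has exactly one solution on `[0, T] × ℕ` for the boundary data `y0`, `ξ`. -/
def UniquelySolvable (S : DRP E F) (y0 : ℝ → F) (ξ : ℕ → E) : Prop :=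
  ∃ x y, S.IsSolution y0 ξ x y ∧
    ∀ x' y', S.IsSolution y0 ξ x' y' →
      ∀ k, EqOn (x' (k + 1)) (x (k + 1)) (Icc 0 S.T) ∧ EqOn (y' k) (y k) (Icc 0 S.T)

/-- Lyapunov stability of the origin. -/
def IsStable (S : DRP E F) : Prop :=
  ∀ ε > (0 : ℝ), ∃ δ ∈ Ioo 0 ε, ∀ (y0 : ℝ → F) (ξ : ℕ → E), ContDiffOn ℝ 1 y0 (Icc 0 S.T) →
    supNorm S.T y0 + expNorm 1 ξ < ENNReal.ofReal δ →
      S.UniquelySolvable y0 ξ ∧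
        ∀ x y, S.IsSolution y0 ξ x y → ∀ k, supNorm S.T (y k) < ENNReal.ofReal ε

/-- Asymptotic stability of the origin. -/
def IsAsymptoticallyStable (S : DRP E F) : Prop :=
  S.IsStable ∧
  ∃ δ > (0 : ℝ), ∀ (y0 : ℝ → F) (ξ : ℕ → E), ContDiffOn ℝ 1 y0 (Icc 0 S.T) →
    supNorm S.T y0 + expNorm 1 ξ < ENNReal.ofReal δ → Tendsto ξ atTop (𝓝 0) →
      S.UniquelySolvable y0 ξ ∧
        ∀ x y, S.IsSolution y0 ξ x y → Tendsto (fun k => supNorm S.T (y k)) atTop (𝓝 0)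

/-- (Local) exponential stability of the origin. -/
def IsExponentiallyStable (S : DRP E F) : Prop :=
  S.IsAsymptoticallyStable ∧
  ∃ δ > (0 : ℝ), ∃ K γ : ℝ → ℝ,
    ContinuousOn K (Ioo 0 1) ∧ StrictMonoOn K (Ioo 0 1) ∧ MapsTo K (Ioo 0 1) (Ici 1) ∧
    ContinuousOn γ (Ioo 0 1) ∧ StrictMonoOn γ (Ioo 0 1) ∧ MapsTo γ (Ioo 0 1) (Ioo 0 1) ∧
    ∀ l ∈ Ioo (0 : ℝ) 1, ∀ (y0 : ℝ → F) (ξ : ℕ → E), ContDiffOn ℝ 1 y0 (Icc 0 S.T) →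
      supNorm S.T y0 + expNorm l ξ < ENNReal.ofReal δ →
        S.UniquelySolvable y0 ξ ∧
          ∀ x y, S.IsSolution y0 ξ x y → ∀ k,
            supNorm S.T (y k) ≤
              ENNReal.ofReal (K l * γ l ^ k) * (supNorm S.T y0 + expNorm l ξ)

/-- The DRP in the coordinates `(x_k - xs, y_k - ys)`. -/
noncomputable def translate (S : DRP E F) (xs : ℝ → E) (ys : ℝ → F) : DRP E F where
  T := S.T
  f χ u t := S.f (χ + xs t) (u + ys t) t - derivWithin xs (Icc 0 S.T) t
  g χ u t := S.g (χ + xs t) (u + ys t) t - ys t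

/-- The Picard iteration of `x' = f (x, t)` on `[0, T]`, as a DRP:
`x_{k+1}' (t) = f (y_k t) t` and `y_{k+1} t = x_{k+1} t`. -/
def picard (f : E → ℝ → E) (T : ℝ) : DRP E E where
  T := T
  f _ u t := f u t
  g χ _ _ := χ

end DRP

/-! On a compact tube around the graph of `xs`, `f` is Lipschitz in space with one constant `L`.
Measured with the weight `exp (-4 * L * t)`, one Picard step divides the distance to `xs` by 4 and
adds the error of the new initial state (`norm_sub_le_of_picard_step`). So any sequence with `‖ξ k‖
+ a k / 4 ≤ a (k + 1)` that majorizes the initial error bounds all iterates, up to the factor `exp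
(4 * L * T)`, as long as this bound keeps them in the tube
(`picard_translate_uniquelySolvable_and_norm_le`). The stability notions differ only in the
majorant: a constant, the exact solution of the recursion, or a geometric sequence. -/

/-! ### Pointwise bounds from the extended norms -/

section Norms

variable {E : Type*} [NormedAddCommGroup E]

theorem norm_le_toReal_supNorm_add {T : ℝ} {u : ℝ → E} {b : ℝ≥0∞} (h : supNorm T u + b ≠ ∞)
    {t : ℝ} (ht : t ∈ Icc 0 T) : ‖u t‖ ≤ (supNorm T u + b).toReal := by
  have h1 : ‖u t‖ₑ ≤ supNorm T u + b :=
    (le_iSup₂ (f := fun t (_ : t ∈ Icc (0 : ℝ) T) => ‖u t‖ₑ) t ht).trans le_self_add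
  simpa using ENNReal.toReal_mono h h1

theorem norm_le_pow_mul_toReal_add_expNorm {l : ℝ} (hl : 0 < l) {b : ℕ → E} {c : ℝ≥0∞}
    (h : c + expNorm l b ≠ ∞) (k : ℕ) : ‖b k‖ ≤ l ^ k * (c + expNorm l b).toReal := by
  have h1 : ENNReal.ofReal ((l ^ k)⁻¹) * ‖b k‖ₑ ≤ c + expNorm l b :=
    (le_iSup (fun k : ℕ => ENNReal.ofReal ((l ^ k)⁻¹) * ‖b k‖ₑ) k).trans le_add_self
  have h2 := ENNReal.toReal_mono h h1
  have hlk : 0 < l ^ k := pow_pos hl k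
  rw [ENNReal.toReal_mul, ENNReal.toReal_ofReal (inv_nonneg.2 hlk.le), toReal_enorm] at h2
  rwa [inv_mul_le_iff₀ hlk] at h2

theorem supNorm_le_ofReal {T : ℝ} {u : ℝ → E} {C : ℝ} (h : ∀ t ∈ Icc 0 T, ‖u t‖ ≤ C) :
    supNorm T u ≤ ENNReal.ofReal C :=
  iSup₂_le fun t ht => by
    rw [← ofReal_norm]
    exact ENNReal.ofReal_le_ofReal (h t ht)

end Norms

/-- A sequence that satisfies a contractive recursion with a vanishing perturbation vanishes. -/
theorem tendsto_zero_of_contractive_recursion {a β : ℕ → ℝ} (ha : ∀ k, 0 ≤ a k)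
    (h : ∀ k, a (k + 1) ≤ β k + a k / 4) (hβ : Tendsto β atTop (𝓝 0)) :
    Tendsto a atTop (𝓝 0) := by
  rw [Metric.tendsto_atTop]
  intro ε hε
  obtain ⟨N, hN⟩ := Metric.tendsto_atTop.1 hβ (ε / 4) (by positivity)
  -- The bound `ε / 2` reproduces itself: `ε / 4 + (ε / 2) / 4 ≤ ε / 2`.
  have key : ∀ m, a (N + m) ≤ a N * (1 / 4) ^ m + ε / 2 := by
    intro m
    induction m with
    | zero => simp; positivity
    | succ m ih =>
      have h1 := h (N + m)
      have h2 := hN (N + m) (by omega)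
      rw [Real.dist_eq, sub_zero] at h2
      have h3 := (abs_lt.1 h2).2
      rw [← add_assoc, pow_succ]
      linarith
  have hlim : Tendsto (fun m : ℕ => a N * (1 / 4 : ℝ) ^ m) atTop (𝓝 0) := by
    simpa using (tendsto_pow_atTop_nhds_zero_of_lt_one (r := (1 / 4 : ℝ)) (by norm_num)
      (by norm_num)).const_mul (a N)
  obtain ⟨M, hM⟩ := eventually_atTop.1 (hlim.eventually_lt_const (half_pos hε))
  refine ⟨N + M, fun n hn => ?_⟩
  obtain ⟨m, rfl⟩ := Nat.exists_eq_add_of_le ((Nat.le_add_right N M).trans hn)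
  rw [Real.dist_eq, sub_zero, abs_of_nonneg (ha _)]
  linarith [key m, hM m (by omega)]

/-! ### Primitives on a compact interval -/

section Primitive

variable {E : Type*} [NormedAddCommGroup E] [NormedSpace ℝ E]

theorem eqOn_Icc_of_hasDerivWithinAt_eq {T : ℝ} {u v g : ℝ → E}
    (hu : ∀ t ∈ Icc 0 T, HasDerivWithinAt u (g t) (Icc 0 T) t)
    (hv : ∀ t ∈ Icc 0 T, HasDerivWithinAt v (g t) (Icc 0 T) t) (h0 : u 0 = v 0) :
    EqOn u v (Icc 0 T) := by
  refine eq_of_has_deriv_right_eq (f' := g) (fun t ht => ?_) (fun t ht => ?_)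
    (fun t ht => (hu t ht).continuousWithinAt) (fun t ht => (hv t ht).continuousWithinAt) h0
  · exact (hu t (Ico_subset_Icc_self ht)).mono_of_mem_nhdsWithin (Icc_mem_nhdsGE_of_mem ht)
  · exact (hv t (Ico_subset_Icc_self ht)).mono_of_mem_nhdsWithin (Icc_mem_nhdsGE_of_mem ht)

/-- The primitive on `[0, T]` of `g` with initial value `η`, extended to the whole line. -/
noncomputable def primitiveIcc (T : ℝ) (η : E) (g : ℝ → E) (t : ℝ) : E :=
  η + ∫ s in (0 : ℝ)..t, g (max 0 (min T s))

/-- Freezing `g` at its endpoint values outside `[0, T]` makes the integrand continuous on the line,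
so the primitive has a two-sided derivative even at the endpoints. -/
theorem continuous_comp_clamp {E : Type*} [TopologicalSpace E] {T : ℝ} {g : ℝ → E} (hT : 0 ≤ T) (hg : ContinuousOn g (Icc 0 T)) :
    Continuous fun s => g (max 0 (min T s)) :=
  hg.comp_continuous (by fun_prop) fun s => ⟨le_max_left _ _, max_le hT (min_le_left _ _)⟩

variable [CompleteSpace E] {T : ℝ} {g : ℝ → E}

theorem hasDerivAt_primitiveIcc (hT : 0 ≤ T) (hg : ContinuousOn g (Icc 0 T)) (η : E) (t : ℝ) :
    HasDerivAt (primitiveIcc T η g) (g (max 0 (min T t))) t :=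
  ((continuous_comp_clamp hT hg).integral_hasStrictDerivAt 0 t).hasDerivAt.const_add η

theorem hasDerivWithinAt_primitiveIcc (hg : ContinuousOn g (Icc 0 T)) (η : E) {t : ℝ}
    (ht : t ∈ Icc 0 T) : HasDerivWithinAt (primitiveIcc T η g) (g t) (Icc 0 T) t := by
  have h := hasDerivAt_primitiveIcc (ht.1.trans ht.2) hg η t
  rw [min_eq_right ht.2, max_eq_right ht.1] at h
  exact h.hasDerivWithinAt

theorem contDiff_primitiveIcc (hT : 0 ≤ T) (hg : ContinuousOn g (Icc 0 T)) (η : E) :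
    ContDiff ℝ 1 (primitiveIcc T η g) := by
  rw [contDiff_one_iff_deriv]
  have h := hasDerivAt_primitiveIcc hT hg η
  refine ⟨fun t => (h t).differentiableAt, ?_⟩
  rw [funext fun t => (h t).deriv]
  exact continuous_comp_clamp hT hg

/-- On `[0, T]`, `u` coincides with a globally `C^1` primitive. This avoids unique differentiability
of the interval, which fails for `T = 0`. -/
theorem contDiffOn_one_of_hasDerivWithinAt {u : ℝ → E} (hT : 0 ≤ T)
    (hg : ContinuousOn g (Icc 0 T))
    (hu : ∀ t ∈ Icc 0 T, HasDerivWithinAt u (g t) (Icc 0 T) t) : ContDiffOn ℝ 1 u (Icc 0 T) :=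
  (contDiff_primitiveIcc hT hg (u 0)).contDiffOn.congr <|
    eqOn_Icc_of_hasDerivWithinAt_eq hu
      (fun _ ht => hasDerivWithinAt_primitiveIcc hg (u 0) ht) (by simp [primitiveIcc])

end Primitive

/-- A function that is `C^1` near the graph of a continuous curve over `[0, T]` is uniformly
Lipschitz in the space variable on a tube around the curve. -/
theorem exists_lipschitz_tube {E : Type*} [NormedAddCommGroup E] [NormedSpace ℝ E]
    {T : ℝ} {f : E → ℝ → E} {xs : ℝ → E} {W : Set (E × ℝ)} (hW : IsOpen W)
    (hf : ContDiffOn ℝ 1 (fun p : E × ℝ => f p.1 p.2) (W ∩ (univ ×ˢ Icc 0 T)))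
    (hgraph : ∀ t ∈ Icc 0 T, (xs t, t) ∈ W) (hxs : ContinuousOn xs (Icc 0 T)) :
    ∃ r > (0 : ℝ), ∃ L ≥ (0 : ℝ), ∀ t ∈ Icc 0 T, ∀ u, ‖u - xs t‖ ≤ r →
      (u, t) ∈ W ∧ ‖f u t - f (xs t) t‖ ≤ L * ‖u - xs t‖ := by
  -- The doubled membership fits compactness induction, whose predicate ranges over arbitrary sets
  -- of times.
  have key : ∃ r > (0 : ℝ), ∃ L ≥ (0 : ℝ), ∀ t ∈ Icc 0 T, t ∈ Icc 0 T → ∀ u, ‖u - xs t‖ ≤ r →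
      (u, t) ∈ W ∧ ‖f u t - f (xs t) t‖ ≤ L * ‖u - xs t‖ := by
    refine isCompact_Icc.induction_on (p := fun S : Set ℝ => ∃ r > (0 : ℝ), ∃ L ≥ (0 : ℝ),
      ∀ t ∈ S, t ∈ Icc 0 T → ∀ u, ‖u - xs t‖ ≤ r →
        (u, t) ∈ W ∧ ‖f u t - f (xs t) t‖ ≤ L * ‖u - xs t‖) ?_ ?_ ?_ ?_
    · exact ⟨1, one_pos, 0, le_rfl, by simp⟩
    · rintro s t hst ⟨r, hr, L, hL, h⟩
      exact ⟨r, hr, L, hL, fun τ hτ => h τ (hst hτ)⟩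
    · rintro s t ⟨r, hr, L, hL, h⟩ ⟨r', hr', L', hL', h'⟩
      refine ⟨min r r', lt_min hr hr', max L L', hL.trans (le_max_left _ _), ?_⟩
      rintro τ (hτ | hτ) hτI u hu
      · obtain ⟨h1, h2⟩ := h τ hτ hτI u (hu.trans (min_le_left _ _))
        exact ⟨h1, h2.trans (mul_le_mul_of_nonneg_right (le_max_left _ _) (norm_nonneg _))⟩
      · obtain ⟨h1, h2⟩ := h' τ hτ hτI u (hu.trans (min_le_right _ _))
        exact ⟨h1, h2.trans (mul_le_mul_of_nonneg_right (le_max_right _ _) (norm_nonneg _))⟩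
    · intro t ht
      have hmem : (xs t, t) ∈ (univ ×ˢ Icc 0 T : Set (E × ℝ)) := ⟨mem_univ _, ht⟩
      have hWn : W ∈ 𝓝 (xs t, t) := hW.mem_nhds (hgraph t ht)
      -- Near the graph `W` can be dropped; the remaining domain is convex, as the local Lipschitz
      -- estimate requires.
      have hfd : ContDiffWithinAt ℝ 1 (fun p : E × ℝ => f p.1 p.2) (univ ×ˢ Icc 0 T) (xs t, t) := by
        have := hf (xs t, t) ⟨hgraph t ht, hmem⟩
        rwa [inter_comm, contDiffWithinAt_inter hWn] at this
      obtain ⟨K, U, hU, hK⟩ := hfd.exists_lipschitzOnWith (convex_univ.prod (convex_Icc 0 T))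
      obtain ⟨V, hV, hVU⟩ := mem_nhdsWithin_iff_exists_mem_nhds_inter.1 hU
      obtain ⟨ρ, hρ, hball⟩ := Metric.mem_nhds_iff.1 (inter_mem hV hWn)
      -- Points within `ρ / 4` of `xs τ` stay within `3 * ρ / 4` of `xs t`.
      refine ⟨{τ | dist (xs τ) (xs t) < ρ / 2 ∧ dist τ t < ρ}, ?_, ρ / 4, by positivity,
        K, K.2, ?_⟩
      · refine inter_mem ?_ (mem_nhdsWithin_of_mem_nhds (Metric.ball_mem_nhds t hρ))
        exact (hxs t ht) (Metric.ball_mem_nhds _ (half_pos hρ))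
      · rintro τ ⟨hτ1, hτ2⟩ hτI u hu
        have hu' : dist u (xs t) < ρ := by
          have := dist_triangle u (xs τ) (xs t)
          rw [dist_eq_norm u (xs τ)] at this
          linarith
        have m1 : (u, τ) ∈ Metric.ball (xs t, t) ρ := by
          rw [Metric.mem_ball, Prod.dist_eq]; exact max_lt hu' hτ2
        have m2 : (xs τ, τ) ∈ Metric.ball (xs t, t) ρ := by
          rw [Metric.mem_ball, Prod.dist_eq]; exact max_lt (hτ1.trans (by linarith)) hτ2
        refine ⟨(hball m1).2, ?_⟩
        have := hK.dist_le_mul _ (hVU ⟨(hball m1).1, mem_univ _, hτI⟩) _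
          (hVU ⟨(hball m2).1, mem_univ _, hτI⟩)
        simpa [Prod.dist_eq, dist_eq_norm] using this
  obtain ⟨r, hr, L, hL, h⟩ := key
  exact ⟨r, hr, L, hL, fun t ht => h t ht ht⟩

namespace DRP

/-! ### Change of coordinates -/

section Translate

variable {E F : Type*} [NormedAddCommGroup E] [NormedSpace ℝ E]
  [NormedAddCommGroup F] [NormedSpace ℝ F] {S : DRP E F} {xs : ℝ → E} {ys : ℝ → F}

theorem IsSolution.translate {y0 : ℝ → F} {ξ : ℕ → E} {x : ℕ → ℝ → E} {y : ℕ → ℝ → F}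
    (hxs : DifferentiableOn ℝ xs (Icc 0 S.T)) (hys : ContDiffOn ℝ 1 ys (Icc 0 S.T))
    (h : S.IsSolution y0 ξ x y) :
    (S.translate xs ys).IsSolution (y0 - ys) (fun k => ξ k - xs 0) (fun k => x k - xs)
      (fun k => y k - ys) where
  output_zero t ht := by simp [h.output_zero ht]
  output_contDiff k := (h.output_contDiff k).sub hys
  state_zero k := by simp [h.state_zero k]
  state_deriv k t ht := by
    simpa [DRP.translate] using (h.state_deriv k t ht).sub (hxs t ht).hasDerivWithinAt
  output_succ k t ht := by simp [DRP.translate, h.output_succ k t ht]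

theorem IsSolution.of_translate {y0 : ℝ → F} {ξ : ℕ → E} {x : ℕ → ℝ → E} {y : ℕ → ℝ → F}
    (hxs : DifferentiableOn ℝ xs (Icc 0 S.T)) (hys : ContDiffOn ℝ 1 ys (Icc 0 S.T))
    (h : (S.translate xs ys).IsSolution y0 ξ x y) :
    S.IsSolution (y0 + ys) (fun k => ξ k + xs 0) (fun k => x k + xs) (fun k => y k + ys) where
  output_zero t ht := by
    have : y 0 t = y0 t := h.output_zero ht
    simp [this]
  output_contDiff k := (h.output_contDiff k).add hys
  state_zero k := by simp [h.state_zero k]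
  state_deriv k t ht := by
    simpa [DRP.translate] using (h.state_deriv k t ht).add (hxs t ht).hasDerivWithinAt
  output_succ k t ht := by
    have : y (k + 1) t = S.g (x (k + 1) t + xs t) (y k t + ys t) t - ys t := h.output_succ k t ht
    simp [this]

theorem UniquelySolvable.of_translate {y0 : ℝ → F} {ξ : ℕ → E}
    (hxs : DifferentiableOn ℝ xs (Icc 0 S.T)) (hys : ContDiffOn ℝ 1 ys (Icc 0 S.T))
    (h : (S.translate xs ys).UniquelySolvable (y0 - ys) (fun k => ξ k - xs 0)) :
    S.UniquelySolvable y0 ξ := by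
  obtain ⟨x, y, hxy, huniq⟩ := h
  refine ⟨fun k => x k + xs, fun k => y k + ys, ?_, fun x' y' h' k => ?_⟩
  · simpa using hxy.of_translate hxs hys
  · obtain ⟨h1, h2⟩ := huniq _ _ (h'.translate hxs hys) k
    exact ⟨fun t ht => sub_eq_iff_eq_add.1 (h1 ht), fun t ht => sub_eq_iff_eq_add.1 (h2 ht)⟩

theorem UniquelySolvable.translate {y0 : ℝ → F} {ξ : ℕ → E}
    (hxs : DifferentiableOn ℝ xs (Icc 0 S.T)) (hys : ContDiffOn ℝ 1 ys (Icc 0 S.T))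
    (h : S.UniquelySolvable (y0 + ys) (fun k => ξ k + xs 0)) :
    (S.translate xs ys).UniquelySolvable y0 ξ := by
  obtain ⟨x, y, hxy, huniq⟩ := h
  refine ⟨fun k => x k - xs, fun k => y k - ys, ?_, fun x' y' h' k => ?_⟩
  · simpa using hxy.translate hxs hys
  · obtain ⟨h1, h2⟩ := huniq _ _ (h'.of_translate hxs hys) k
    exact ⟨fun t ht => eq_sub_of_add_eq (h1 ht), fun t ht => eq_sub_of_add_eq (h2 ht)⟩

end Translate

/-! ### Picard iterates and their error -/

section Picard

variable {E : Type*} [NormedAddCommGroup E] [NormedSpace ℝ E]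

/-- The right-hand side involves only the previous output, so each state is a primitive fixed by its
initial value; no Lipschitz condition enters. -/
theorem IsSolution.picard_unique {f : E → ℝ → E} {T : ℝ} {y0 : ℝ → E} {ξ : ℕ → E}
    {x y x' y' : ℕ → ℝ → E} (h : (picard f T).IsSolution y0 ξ x y)
    (h' : (picard f T).IsSolution y0 ξ x' y') (k : ℕ) :
    EqOn (x' (k + 1)) (x (k + 1)) (Icc 0 T) ∧ EqOn (y' k) (y k) (Icc 0 T) := by
  have step : ∀ k, EqOn (y' k) (y k) (Icc 0 T) → EqOn (x' (k + 1)) (x (k + 1)) (Icc 0 T) := by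
    intro k hk
    refine eqOn_Icc_of_hasDerivWithinAt_eq (g := fun t => f (y k t) t) (fun t ht => ?_)
      (h.state_deriv k) ((h'.state_zero k).trans (h.state_zero k).symm)
    rw [← hk ht]
    exact h'.state_deriv k t ht
  have out : ∀ k, EqOn (y' k) (y k) (Icc 0 T) := by
    intro k
    induction k with
    | zero => exact fun t ht => (h'.output_zero ht).trans (h.output_zero ht).symm
    | succ k ih =>
      exact fun t ht => (h'.output_succ k t ht).trans ((step k ih ht).trans
        (h.output_succ k t ht).symm)
  exact ⟨step k (out k), out k⟩

/-- The Picard iterates with varying initial states. -/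
noncomputable def picardIterate (f : E → ℝ → E) (T : ℝ) (y0 : ℝ → E) (ξ : ℕ → E) : ℕ → ℝ → E
  | 0 => y0
  | k + 1 => primitiveIcc T (ξ k) fun t => f (picardIterate f T y0 ξ k t) t

variable {T r L : ℝ} {f : E → ℝ → E} {xs : ℝ → E} {W : Set (E × ℝ)}

/-- One Picard step contracts the exponentially weighted distance to the solution `xs`. -/
theorem norm_sub_le_of_picard_step (hL : 0 ≤ L)
    (htube : ∀ t ∈ Icc 0 T, ∀ u, ‖u - xs t‖ ≤ r →
      (u, t) ∈ W ∧ ‖f u t - f (xs t) t‖ ≤ L * ‖u - xs t‖)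
    (hxs : ∀ t ∈ Icc 0 T, HasDerivWithinAt xs (f (xs t) t) (Icc 0 T) t) {u v : ℝ → E} {a : ℝ}
    (hv : ∀ t ∈ Icc 0 T, HasDerivWithinAt v (f (u t) t) (Icc 0 T) t)
    (hu : ∀ t ∈ Icc 0 T, ‖u t - xs t‖ ≤ a * Real.exp (4 * L * t))
    (hur : ∀ t ∈ Icc 0 T, ‖u t - xs t‖ ≤ r) (ha : 0 ≤ a) {t : ℝ} (ht : t ∈ Icc 0 T) :
    ‖v t - xs t‖ ≤ (‖v 0 - xs 0‖ + a / 4) * Real.exp (4 * L * t) := by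
  have hd : ∀ t ∈ Icc 0 T,
      HasDerivWithinAt (fun t => v t - xs t) (f (u t) t - f (xs t) t) (Icc 0 T) t :=
    fun t ht => (hv t ht).sub (hxs t ht)
  -- The error's derivative is at most `L * a * exp (4 * L * t)`, which is the derivative of `(a /
  -- 4) * exp (4 * L * t)`: the 4 in the exponent gives the factor `1 / 4`.
  refine image_norm_le_of_norm_deriv_right_le_deriv_boundary
    (B := fun t => (‖v 0 - xs 0‖ + a / 4) * Real.exp (4 * L * t))
    (B' := fun t => (‖v 0 - xs 0‖ + a / 4) * (Real.exp (4 * L * t) * (4 * L)))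
    (fun t ht => (hd t ht).continuousWithinAt)
    (fun t ht => (hd t (Ico_subset_Icc_self ht)).mono_of_mem_nhdsWithin
      (Icc_mem_nhdsGE_of_mem ht)) ?_ (fun t => ?_) (fun t ht => ?_) ht
  · simp only [mul_zero, Real.exp_zero, mul_one]
    linarith
  · have h := ((hasDerivAt_id t).const_mul (4 * L)).exp.const_mul (‖v 0 - xs 0‖ + a / 4)
    simpa using h
  · have ht' := Ico_subset_Icc_self ht
    have h1 := (htube t ht' (u t) (hur t ht')).2
    have h2 := mul_le_mul_of_nonneg_left (hu t ht') hL
    have h3 : 0 ≤ ‖v 0 - xs 0‖ * (Real.exp (4 * L * t) * (4 * L)) := by positivity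
    linarith

theorem continuousOn_comp_of_mem_tube
    (hf : ContDiffOn ℝ 1 (fun p : E × ℝ => f p.1 p.2) (W ∩ (univ ×ˢ Icc 0 T)))
    (htube : ∀ t ∈ Icc 0 T, ∀ u, ‖u - xs t‖ ≤ r →
      (u, t) ∈ W ∧ ‖f u t - f (xs t) t‖ ≤ L * ‖u - xs t‖)
    {u : ℝ → E} (hu : ContinuousOn u (Icc 0 T)) (hur : ∀ t ∈ Icc 0 T, ‖u t - xs t‖ ≤ r) :
    ContinuousOn (fun t => f (u t) t) (Icc 0 T) :=
  hf.continuousOn.comp (hu.prodMk continuousOn_id) fun t ht =>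
    ⟨(htube t ht (u t) (hur t ht)).1, mem_univ _, ht⟩

/-- Regularity and error bound of successive Picard iterates `y k` with initial states `ξ k`, where
`a` is a majorant of the initial error and of the errors made by the initial states. -/
theorem contDiffOn_and_norm_sub_le_of_picard_steps [CompleteSpace E] (hT : 0 ≤ T)
    (hf : ContDiffOn ℝ 1 (fun p : E × ℝ => f p.1 p.2) (W ∩ (univ ×ˢ Icc 0 T))) (hL : 0 ≤ L)
    (htube : ∀ t ∈ Icc 0 T, ∀ u, ‖u - xs t‖ ≤ r →
      (u, t) ∈ W ∧ ‖f u t - f (xs t) t‖ ≤ L * ‖u - xs t‖)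
    (hxs : ∀ t ∈ Icc 0 T, HasDerivWithinAt xs (f (xs t) t) (Icc 0 T) t)
    {y : ℕ → ℝ → E} {a : ℕ → ℝ} (ha : ∀ k, 0 ≤ a k)
    (har : ∀ k, a k * Real.exp (4 * L * T) ≤ r)
    (hy0 : ContDiffOn ℝ 1 (y 0) (Icc 0 T)) (ha0 : ∀ t ∈ Icc 0 T, ‖y 0 t - xs t‖ ≤ a 0)
    (hak : ∀ k, ‖y (k + 1) 0 - xs 0‖ + a k / 4 ≤ a (k + 1))
    (hstep : ∀ k, ContinuousOn (fun t => f (y k t) t) (Icc 0 T) →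
      ∀ t ∈ Icc 0 T, HasDerivWithinAt (y (k + 1)) (f (y k t) t) (Icc 0 T) t) (k : ℕ) :
    ContDiffOn ℝ 1 (y k) (Icc 0 T) ∧ ContinuousOn (fun t => f (y k t) t) (Icc 0 T) ∧
      ∀ t ∈ Icc 0 T, ‖y k t - xs t‖ ≤ a k * Real.exp (4 * L * T) := by
  have hexp : ∀ t ∈ Icc 0 T, Real.exp (4 * L * t) ≤ Real.exp (4 * L * T) := fun t ht =>
    Real.exp_le_exp.2 (mul_le_mul_of_nonneg_left ht.2 (by positivity))
  have hunif : ∀ k, (∀ t ∈ Icc 0 T, ‖y k t - xs t‖ ≤ a k * Real.exp (4 * L * t)) →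
      ∀ t ∈ Icc 0 T, ‖y k t - xs t‖ ≤ a k * Real.exp (4 * L * T) := fun k h t ht =>
    (h t ht).trans (mul_le_mul_of_nonneg_left (hexp t ht) (ha k))
  have hcont : ∀ k, ContDiffOn ℝ 1 (y k) (Icc 0 T) →
      (∀ t ∈ Icc 0 T, ‖y k t - xs t‖ ≤ a k * Real.exp (4 * L * t)) →
      ContinuousOn (fun t => f (y k t) t) (Icc 0 T) := fun k h1 h2 =>
    continuousOn_comp_of_mem_tube hf htube h1.continuousOn fun t ht =>
      (hunif k h2 t ht).trans (har k)
  -- The induction carries the weighted bound; passing to the uniform one at each step would lose a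
  -- factor `exp (4 * L * T)` every time.
  have key : ∀ k, ContDiffOn ℝ 1 (y k) (Icc 0 T) ∧
      ∀ t ∈ Icc 0 T, ‖y k t - xs t‖ ≤ a k * Real.exp (4 * L * t) := by
    intro k
    induction k with
    | zero =>
      refine ⟨hy0, fun t ht => (ha0 t ht).trans (le_mul_of_one_le_right (ha 0) ?_)⟩
      exact Real.one_le_exp (mul_nonneg (by positivity) ht.1)
    | succ k ih =>
      have hc := hcont k ih.1 ih.2
      refine ⟨contDiffOn_one_of_hasDerivWithinAt hT hc (hstep k hc), fun t ht => ?_⟩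
      exact (norm_sub_le_of_picard_step hL htube hxs (hstep k hc) ih.2
        (fun t ht => (hunif k ih.2 t ht).trans (har k)) (ha k) ht).trans
        (mul_le_mul_of_nonneg_right (hak k) (Real.exp_pos _).le)
  exact ⟨(key k).1, hcont k (key k).1 (key k).2, hunif k (key k).2⟩

/-- Unique solvability and error bound in the coordinates relative to the solution `xs`. -/
theorem picard_translate_uniquelySolvable_and_norm_le [CompleteSpace E] (hT : 0 ≤ T)
    (hf : ContDiffOn ℝ 1 (fun p : E × ℝ => f p.1 p.2) (W ∩ (univ ×ˢ Icc 0 T))) (hL : 0 ≤ L)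
    (htube : ∀ t ∈ Icc 0 T, ∀ u, ‖u - xs t‖ ≤ r →
      (u, t) ∈ W ∧ ‖f u t - f (xs t) t‖ ≤ L * ‖u - xs t‖)
    (hxs : ∀ t ∈ Icc 0 T, HasDerivWithinAt xs (f (xs t) t) (Icc 0 T) t)
    (hxs1 : ContDiffOn ℝ 1 xs (Icc 0 T))
    {y0 : ℝ → E} {ξ : ℕ → E} (hy0 : ContDiffOn ℝ 1 y0 (Icc 0 T)) {a : ℕ → ℝ}
    (har : ∀ k, a k * Real.exp (4 * L * T) ≤ r) (ha0 : ∀ t ∈ Icc 0 T, ‖y0 t‖ ≤ a 0)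
    (hak : ∀ k, ‖ξ k‖ + a k / 4 ≤ a (k + 1)) :
    ((picard f T).translate xs xs).UniquelySolvable y0 ξ ∧
      ∀ x y, ((picard f T).translate xs xs).IsSolution y0 ξ x y →
        ∀ k, ∀ t ∈ Icc 0 T, ‖y k t‖ ≤ a k * Real.exp (4 * L * T) := by
  have hdiff : DifferentiableOn ℝ xs (Icc 0 (picard f T).T) := fun t ht =>
    (hxs t ht).differentiableWithinAt
  have ha : ∀ k, 0 ≤ a k := by
    intro k
    induction k with
    | zero => exact (norm_nonneg _).trans (ha0 0 ⟨le_rfl, hT⟩)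
    | succ k ih => exact (by positivity : 0 ≤ ‖ξ k‖ + a k / 4).trans (hak k)
  constructor
  · apply UniquelySolvable.translate hdiff hxs1
    -- The explicit iterates are known to satisfy the differential equation only once the integrand
    -- is continuous, hence the premise in `hstep`.
    have hit := contDiffOn_and_norm_sub_le_of_picard_steps hT hf hL htube hxs ha har
      (y := picardIterate f T (y0 + xs) fun k => ξ k + xs 0) (hy0.add hxs1)
      (by simpa [picardIterate] using ha0) (by simpa [picardIterate, primitiveIcc] using hak)
      (fun k hc t ht => hasDerivWithinAt_primitiveIcc hc _ ht)
    have hsol : (picard f T).IsSolution (y0 + xs) (fun k => ξ k + xs 0)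
        (picardIterate f T (y0 + xs) fun k => ξ k + xs 0)
        (picardIterate f T (y0 + xs) fun k => ξ k + xs 0) :=
      ⟨fun t _ => rfl, fun k => (hit k).1, fun k => by simp [picardIterate, primitiveIcc],
        fun k t ht => hasDerivWithinAt_primitiveIcc (hit k).2.1 _ ht, fun k t _ => rfl⟩
    exact ⟨_, _, hsol, fun x' y' h' k => hsol.picard_unique h' k⟩
  · intro x y h k t ht
    have hs := h.of_translate hdiff hxs1
    have h0 : ∀ k, y (k + 1) 0 = ξ k := fun k => by
      have h1 := hs.output_succ k 0 ⟨le_rfl, hT⟩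
      have h2 := hs.state_zero k
      simp only [picard] at h1
      rw [h2] at h1
      simpa using h1
    have hb := (contDiffOn_and_norm_sub_le_of_picard_steps hT hf hL htube hxs ha har
      (y := fun k => y k + xs) (hs.output_contDiff 0)
      (fun t ht => by
        have h1 : y 0 t = y0 t := h.output_zero ht
        simpa [h1] using ha0 t ht)
      (fun k => by simpa [h0 k] using hak k)
      (fun k _ t ht => (hs.state_deriv k t ht).congr (fun s hs' => hs.output_succ k s hs')
        (hs.output_succ k t ht)) k).2.2 t ht
    simpa using hb

end Picard

end DRP

/-! ### Choice of majorants and constants -/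

theorem mainTheorem9 {E : Type*} [NormedAddCommGroup E] [NormedSpace ℝ E] [FiniteDimensional ℝ E]
    (T : ℝ) (hT : 0 ≤ T) (f : E → ℝ → E) (x0 : E) (xs : ℝ → E)
    -- `f` is `C^1` on a relatively open subset `W ∩ (E × [0, T])` that contains the graph of `xs`
    (W : Set (E × ℝ)) (hW : IsOpen W)
    (hf : ContDiffOn ℝ 1 (fun p : E × ℝ => f p.1 p.2) (W ∩ (univ ×ˢ Icc 0 T)))
    (hgraph : ∀ t ∈ Icc 0 T, (xs t, t) ∈ W)
    -- `xs` solves the initial value problem on `[0, T]`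
    (hxs0 : xs 0 = x0)
    (hxs : ∀ t ∈ Icc 0 T, HasDerivWithinAt xs (f (xs t) t) (Icc 0 T) t) :
    -- the Picard iteration is exponentially stable around `xs`
    ((DRP.picard f T).translate xs xs).IsExponentiallyStable ∧
    -- the iterates converge uniformly to `xs` for boundary data near `(xs, x0)` with `ξ → x0`
    ∃ δ > (0 : ℝ), ∀ (y0 : ℝ → E) (ξ : ℕ → E), ContDiffOn ℝ 1 y0 (Icc 0 T) →
      supNorm T (y0 - xs) + expNorm 1 (fun k => ξ k - x0) < ENNReal.ofReal δ →
      Tendsto ξ atTop (𝓝 x0) →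
        (DRP.picard f T).UniquelySolvable y0 ξ ∧
          ∀ x y, (DRP.picard f T).IsSolution y0 ξ x y →
            Tendsto (fun k => supNorm T (y k - xs)) atTop (𝓝 0) := by
  have : CompleteSpace E := FiniteDimensional.complete ℝ E
  have hxsc : ContinuousOn xs (Icc 0 T) := fun t ht => (hxs t ht).continuousWithinAt
  obtain ⟨r, hr, L, hL, htube⟩ := exists_lipschitz_tube hW hf hgraph hxsc
  have hxs1 : ContDiffOn ℝ 1 xs (Icc 0 T) := by
    refine contDiffOn_one_of_hasDerivWithinAt hT
      (DRP.continuousOn_comp_of_mem_tube hf htube hxsc fun t _ => ?_) hxs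
    simpa using hr.le
  have hdiff : DifferentiableOn ℝ xs (Icc 0 (DRP.picard f T).T) := fun t ht =>
    (hxs t ht).differentiableWithinAt
  set M : ℝ := Real.exp (4 * L * T) with hM
  have hM1 : 1 ≤ M := Real.one_le_exp (by positivity)
  have hM0 : 0 < M := one_pos.trans_le hM1
  have core := fun {y0 : ℝ → E} {ξ : ℕ → E} => DRP.picard_translate_uniquelySolvable_and_norm_le
    (y0 := y0) (ξ := ξ) hT hf hL htube hxs hxs1
  have hδ : 0 < r / (4 * M) := by positivity
  have hsmall : ∀ {δ : ℝ} {N : ℝ≥0∞}, N < ENNReal.ofReal δ → N ≠ ∞ ∧ N.toReal < δ :=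
    fun h => ⟨h.ne_top, ENNReal.toReal_lt_of_lt_ofReal h⟩
  have hstab : ((DRP.picard f T).translate xs xs).IsStable := by
    intro ε hε
    have hm : 0 < min ε r := lt_min hε hr
    -- The constant majorant `4 * N` works since `N + N ≤ 4 * N`; this radius makes `4 * N * M < min
    -- ε r / 2`.
    refine ⟨min ε r / (8 * M), ⟨by positivity, ?_⟩, fun y0 ξ hy0 hN => ?_⟩
    · rw [div_lt_iff₀ (by positivity)]
      nlinarith [min_le_left ε r]
    · obtain ⟨hfin, hlt⟩ := hsmall hN
      set N := (supNorm _ y0 + expNorm 1 ξ).toReal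
      have hN0 : 0 ≤ N := ENNReal.toReal_nonneg
      rw [lt_div_iff₀ (by positivity)] at hlt
      obtain ⟨h1, h2⟩ := core (y0 := y0) (ξ := ξ) hy0 (a := fun _ => 4 * N)
        (fun _ => by linarith [min_le_right ε r])
        (fun t ht => (norm_le_toReal_supNorm_add hfin ht).trans (by linarith))
        (fun k => by
          have := norm_le_pow_mul_toReal_add_expNorm one_pos hfin k
          rw [one_pow, one_mul] at this
          linarith)
      refine ⟨h1, fun x y h k => (supNorm_le_ofReal (h2 x y h k)).trans_lt ?_⟩
      rw [ENNReal.ofReal_lt_ofReal_iff hε]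
      linarith [min_le_left ε r]
  have hasymp : ∀ (y0 : ℝ → E) (ξ : ℕ → E), ContDiffOn ℝ 1 y0 (Icc 0 T) →
      supNorm T y0 + expNorm 1 ξ < ENNReal.ofReal (r / (4 * M)) → Tendsto ξ atTop (𝓝 0) →
      ((DRP.picard f T).translate xs xs).UniquelySolvable y0 ξ ∧
        ∀ x y, ((DRP.picard f T).translate xs xs).IsSolution y0 ξ x y →
          Tendsto (fun k => supNorm T (y k)) atTop (𝓝 0) := by
    intro y0 ξ hy0 hN hξ
    obtain ⟨hfin, hlt⟩ := hsmall hN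
    set N := (supNorm T y0 + expNorm 1 ξ).toReal
    have hN0 : 0 ≤ N := ENNReal.toReal_nonneg
    rw [lt_div_iff₀ (by positivity)] at hlt
    -- Solving the recursion with equality lets `a` inherit the decay of `ξ`; the bound `4 * N`
    -- keeps the iterates in the tube.
    let a : ℕ → ℝ := fun k => Nat.rec N (fun k b => ‖ξ k‖ + b / 4) k
    have ha : ∀ k, 0 ≤ a k ∧ a k ≤ 4 * N := by
      intro k
      induction k with
      | zero => exact ⟨hN0, by change N ≤ _; linarith⟩
      | succ k ih =>
        have := norm_le_pow_mul_toReal_add_expNorm one_pos hfin k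
        rw [one_pow, one_mul] at this
        have hs : a (k + 1) = ‖ξ k‖ + a k / 4 := rfl
        constructor <;> linarith [norm_nonneg (ξ k), ih.1, ih.2]
    obtain ⟨h1, h2⟩ := core (y0 := y0) (ξ := ξ) hy0 (a := a)
      (fun k => by nlinarith [(ha k).2])
      (fun t ht => norm_le_toReal_supNorm_add hfin ht) (fun k => le_rfl)
    refine ⟨h1, fun x y h => ?_⟩
    have hlim : Tendsto a atTop (𝓝 0) :=
      tendsto_zero_of_contractive_recursion (fun k => (ha k).1) (fun k => le_rfl) (by simpa using hξ.norm)
    have hlim' := ENNReal.tendsto_ofReal (hlim.mul_const M)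
    rw [zero_mul, ENNReal.ofReal_zero] at hlim'
    exact tendsto_of_tendsto_of_tendsto_of_le_of_le tendsto_const_nhds hlim' (fun _ => zero_le)
      fun k => supNorm_le_ofReal (h2 x y h k)
  -- The rate `(1 + l) / 2` dominates both `l` and `1 / 2`, so `4 * ((1 + l) / 2) ^ k * N` is a
  -- majorant. The factor `1 + l` in `K` serves only strict monotonicity.
  refine ⟨⟨⟨hstab, r / (4 * M), hδ, hasymp⟩, r / (4 * M), hδ, fun l => 4 * M * (1 + l),
    fun l => (1 + l) / 2, by fun_prop, ?_, ?_, by fun_prop, ?_, ?_, ?_⟩, r / (4 * M), hδ, ?_⟩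
  · exact fun l _ l' _ h => by
      have : 0 < 4 * M := by positivity
      dsimp only
      gcongr
  · exact fun l hl => by
      rw [mem_Ici]
      nlinarith [hl.1]
  · exact fun l _ l' _ h => by dsimp only; linarith
  · exact fun l hl => ⟨by linarith [hl.1], by linarith [hl.2]⟩
  · intro l hl y0 ξ hy0 hN
    obtain ⟨hfin, hlt⟩ := hsmall hN
    set Ne := supNorm _ y0 + expNorm l ξ with hNe
    set N := Ne.toReal
    have hN0 : 0 ≤ N := ENNReal.toReal_nonneg
    rw [lt_div_iff₀ (by positivity)] at hlt
    have hγ0 : 0 ≤ (1 + l) / 2 := by linarith [hl.1]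
    obtain ⟨h1, h2⟩ := core (y0 := y0) (ξ := ξ) hy0 (a := fun k => 4 * ((1 + l) / 2) ^ k * N)
      (fun k => by
        have : ((1 + l) / 2) ^ k * (4 * N * M) ≤ 1 * (4 * N * M) :=
          mul_le_mul_of_nonneg_right (pow_le_one₀ hγ0 (by linarith [hl.2])) (by positivity)
        linarith)
      (fun t ht => (norm_le_toReal_supNorm_add hfin ht).trans (by
        change N ≤ _
        linarith))
      (fun k => by
        have h3 : ‖ξ k‖ ≤ l ^ k * N := norm_le_pow_mul_toReal_add_expNorm hl.1 hfin k
        have h4 : l ^ k * N ≤ ((1 + l) / 2) ^ k * N := mul_le_mul_of_nonneg_right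
          (pow_le_pow_left₀ hl.1.le (by linarith [hl.2]) k) hN0
        have h5 : 0 ≤ l * (((1 + l) / 2) ^ k * N) := mul_nonneg hl.1.le (by positivity)
        rw [pow_succ]
        linarith)
    refine ⟨h1, fun x y h k => (supNorm_le_ofReal (h2 x y h k)).trans ?_⟩
    rw [← ENNReal.ofReal_toReal hfin, ← ENNReal.ofReal_mul (by have := hl.1; positivity)]
    refine ENNReal.ofReal_le_ofReal ?_
    have h3 : 0 ≤ l * (4 * ((1 + l) / 2) ^ k * N * M) := mul_nonneg hl.1.le (by positivity)
    change 4 * ((1 + l) / 2) ^ k * N * M ≤ 4 * M * (1 + l) * ((1 + l) / 2) ^ k * N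
    linarith
  · intro y0 ξ hy0 hN hξ
    subst hxs0
    obtain ⟨h1, h2⟩ := hasymp (y0 - xs) (fun k => ξ k - xs 0) (hy0.sub hxs1) hN
      (by simpa using hξ.sub_const (xs 0))
    exact ⟨h1.of_translate hdiff hxs1, fun x y h => h2 _ _ (h.translate hdiff hxs1)⟩
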